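/- Let $N\ge 1$, $s\in(0,1)$, let $\Omega\subset\mathbb{R}^N$ be a bounded open set (for instance a bounded Lipschitz domain), and let $f\in L^2(\Omega)$. Put $c_{N,s}=\frac{2^{2s}s\,\Gamma(\frac N2+s)}{\pi^{N/2}\Gamma(1-s)}$. For $\delta>0$ let $\partial_\delta\Omega=\{y\in\mathbb{R}^N\setminus\Omega:\ |x-y|<\delta\text{ for some }x\in\Omega\}$, $\Omega_\delta=\Omega\cup\partial_\delta\Omega$, and let $\mathbb{H}_0^{\delta,s}(\Omega)$ be the space of all $v\in L^2(\Omega_\delta)$ with $v=0$ a.e. on $\partial_\delta\Omega$ and $$\int_{\Omega_\delta}\int_{\Omega_\delta\cap B(x,\delta)}\frac{|v(x)-v(y)|^2}{|x-y|^{N+2s}}\,dy\,dx<\infty .$$ For every $\delta>0$ let $u^{\delta,s}$ be the weak solution of the volume-constrained problem $(P_\delta^s)$: $(-\Delta)_\delta^s u=f$ in $\Omega$, $u=0$ on $\partial_\delta\Omega$; that is, $u^{\delta,s}\in\mathbb{H}_0^{\delta,s}(\Omega)$ and $$\frac{c_{N,s}}2\int_{\Omega_\delta}\int_{\Omega_\delta\cap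 B(x,\delta)}\frac{(u^{\delta,s}(x)-u^{\delta,s}(y))(v(x)-v(y))}{|x-y|^{N+2s}}\,dy\,dx=\int_\Omega f v\,dx\qquad\text{for all }v\in\mathbb{H}_0^{\delta,s}(\Omega).$$ Then the fractional Laplacian Dirichlet problem $(P_\infty^s)$: $(-\Delta)^s u=f$ in $\Omega$, $u=0$ on $\mathbb{R}^N\setminus\Omega$, has exactly one weak solution $u^{\infty,s}$ (up to equality a.e.); that is, there is exactly one $u^{\infty,s}$ in $\mathcal{H}_0^s(\Omega)=\{v\in H^s(\mathbb{R}^N): v=0\text{ a.e. on }\mathbb{R}^N\setminus\Omega\}$ with $$\frac{c_{N,s}}2\int_{\mathbb{R}^N}\int_{\mathbb{R}^N}\frac{(u^{\infty,s}(x)-u^{\infty,s}(y))(v(x)-v(y))}{|x-y|^{N+2s}}\,dy\,dx=\int_\Omega f v\,dx\qquad\text{for all }v\in\mathcal{H}_0^s(\Omega).$$ Moreover, up to a subsequence, $u^{\delta,s}\to u^{\infty,s}$ in $L^2(\Omega)$ as $\delta\to+\infty$: every sequence of horizons $\delta_n>0$ with $\delta_n\to+\infty$ has a subsequence $(\delta_{n_k})$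 such that $\|u^{\delta_{n_k},s}-u^{\infty,s}\|_{L^2(\Omega)}\to 0$ as $k\to\infty$. -/

import Mathlib

open MeasureTheory Filter Topology
open scoped ENNReal

namespace RestrictedFrac

/-- The normalization constant `c_{N,s}` of the fractional Laplacian on `ℝ^N`. -/
noncomputable def fracConst (N : ℕ) (s : ℝ) : ℝ :=
  (2 ^ (2 * s) * s * Real.Gamma ((N : ℝ) / 2 + s)) /
    (Real.pi ^ ((N : ℝ) / 2) * Real.Gamma (1 - s))

/-- The nonlocal boundary `∂_δ Ω`: points outside `Ω` at distance less than `δ` from some point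
of `Ω`. -/
def nonlocalBoundary {N : ℕ} (δ : ℝ) (Ω : Set (EuclideanSpace ℝ (Fin N))) :
    Set (EuclideanSpace ℝ (Fin N)) :=
  {y | y ∉ Ω ∧ ∃ x ∈ Ω, ‖x - y‖ < δ}

/-- The nonlocally completed domain `Ω_δ = Ω ∪ ∂_δ Ω`. -/
def completedDomain {N : ℕ} (δ : ℝ) (Ω : Set (EuclideanSpace ℝ (Fin N))) :
    Set (EuclideanSpace ℝ (Fin N)) :=
  Ω ∪ nonlocalBoundary δ Ω

/-- The region of interaction for the horizon `δ`: pairs `(x, y)` with `x ∈ Ω_δ` and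
`y ∈ Ω_δ ∩ B(x, δ)`. -/
def interactionRegion {N : ℕ} (δ : ℝ) (Ω : Set (EuclideanSpace ℝ (Fin N))) :
    Set (EuclideanSpace ℝ (Fin N) × EuclideanSpace ℝ (Fin N)) :=
  {p | p.1 ∈ completedDomain δ Ω ∧ p.2 ∈ completedDomain δ Ω ∩ Metric.ball p.1 δ}

/-- The double integral of `|v x - v y|² / |x - y|^(N + 2 s)` over a region `D` of pairs `(x, y)`,
with values in `[0, ∞]`. -/
noncomputable def gagliardoEnergy {N : ℕ} (s : ℝ)
    (D : Set (EuclideanSpace ℝ (Fin N) × EuclideanSpace ℝ (Fin N)))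
    (v : EuclideanSpace ℝ (Fin N) → ℝ) : ℝ≥0∞ :=
  ∫⁻ p in D, ENNReal.ofReal (|v p.1 - v p.2| ^ 2 / ‖p.1 - p.2‖ ^ ((N : ℝ) + 2 * s))

/-- The double integral of `(u x - u y) (v x - v y) / |x - y|^(N + 2 s)` over a region `D` of
pairs `(x, y)`. It is absolutely convergent if `u` and `v` have finite energy on `D`. -/
noncomputable def gagliardoForm {N : ℕ} (s : ℝ)
    (D : Set (EuclideanSpace ℝ (Fin N) × EuclideanSpace ℝ (Fin N)))
    (u v : EuclideanSpace ℝ (Fin N) → ℝ) : ℝ :=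
  ∫ p in D, ((u p.1 - u p.2) * (v p.1 - v p.2)) / ‖p.1 - p.2‖ ^ ((N : ℝ) + 2 * s)

/-- Membership of (a representative of) `v` in the energy space `ℍ_0^{δ,s}(Ω)`: `v ∈ L²(Ω_δ)`
has finite energy and vanishes a.e. on `∂_δ Ω`. Values of `v` outside `Ω_δ` play no role. -/
structure MemEnergySpace {N : ℕ} (δ s : ℝ) (Ω : Set (EuclideanSpace ℝ (Fin N)))
    (v : EuclideanSpace ℝ (Fin N) → ℝ) : Prop where
  memLp : MemLp v 2 (volume.restrict (completedDomain δ Ω))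
  energy_lt_top : gagliardoEnergy s (interactionRegion δ Ω) v < ∞
  ae_zero : ∀ᵐ x ∂(volume.restrict (nonlocalBoundary δ Ω)), v x = 0

/-- Membership of (a representative of) `v` in the energy space `𝓗_0^s(Ω)` of the fractional
Laplacian: `v ∈ H^s(ℝ^N)` and `v = 0` a.e. on `ℝ^N ∖ Ω`. -/
structure MemFracEnergySpace {N : ℕ} (s : ℝ) (Ω : Set (EuclideanSpace ℝ (Fin N)))
    (v : EuclideanSpace ℝ (Fin N) → ℝ) : Prop where
  memLp : MemLp v 2 (volume : Measure (EuclideanSpace ℝ (Fin N)))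
  energy_lt_top : gagliardoEnergy s Set.univ v < ∞
  ae_zero : ∀ᵐ x ∂(volume.restrict Ωᶜ), v x = 0

/-- `u` is a weak solution of `(-Δ)_δ^s u = f` in `Ω`, `u = 0` on `∂_δ Ω`. -/
structure IsWeakSolution {N : ℕ} (δ s : ℝ) (Ω : Set (EuclideanSpace ℝ (Fin N)))
    (f u : EuclideanSpace ℝ (Fin N) → ℝ) : Prop where
  mem : MemEnergySpace δ s Ω u
  eq : ∀ v : EuclideanSpace ℝ (Fin N) → ℝ, MemEnergySpace δ s Ω v →
    fracConst N s / 2 * gagliardoForm s (interactionRegion δ Ω) u v = ∫ x in Ω, f x * v x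

/-- `u` is a weak solution of `(-Δ)_∞^s u = f` in `Ω`, `u = 0` on `ℝ^N ∖ Ω`, where `(-Δ)_∞^s` is
the fractional Laplacian. -/
structure IsFracWeakSolution {N : ℕ} (s : ℝ) (Ω : Set (EuclideanSpace ℝ (Fin N)))
    (f u : EuclideanSpace ℝ (Fin N) → ℝ) : Prop where
  mem : MemFracEnergySpace s Ω u
  eq : ∀ v : EuclideanSpace ℝ (Fin N) → ℝ, MemFracEnergySpace s Ω v →
    fracConst N s / 2 * gagliardoForm s Set.univ u v = ∫ x in Ω, f x * v x

end RestrictedFrac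

/-! Take `δ` larger than every distance between two points of `Ω`, and `u`, `v` vanishing off `Ω`. A
pair at distance at least `δ` has at most one point in `Ω`, so `(u x - u y) (v x - v y) = u x * v x
+ u y * v y` there. A pair at distance less than `δ` outside the interaction region has no point in
`Ω` and contributes nothing. With `κ(δ)` the mass of the kernel beyond `δ` (`tailMass`), this gives
the exact identity `E(u, v) = E_δ(u, v) + 2 κ(δ) ∫ u v` (`setIntegral_interactionRegion_add_tail`).
So truncation only changes the operator by a zeroth-order term, and the two energy spaces agree.

The identity at a fixed `R` gives the Poincaré inequality `κ(R) ∫ v² ≤ E(v, v)`, hence uniqueness,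
and existence by projection onto the closed space of difference quotients. For `d = u_δ - w`, with
`w` the fractional solution, subtracting the two equations gives `E(d, d) = 2 κ(δ) ∫ u_δ d`.
Poincaré and Young then give `∫ d² ≤ 2 κ(δ) / κ(R) ∫ w²` for large `δ` (`integral_sq_sub_le`). Since
`κ(δ) → 0`, the whole family converges, with a rate and without compactness. -/

namespace RestrictedFrac

/-! ### The tail of the kernel and its mass -/

/-- The kernel `|z|^(-(N + 2 s))` of the fractional Laplacian, cut off to `|z| ≥ r`. -/
noncomputable def tailKernel {N : ℕ} (s r : ℝ) (z : EuclideanSpace ℝ (Fin N)) : ℝ :=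
  {z : EuclideanSpace ℝ (Fin N) | r ≤ ‖z‖}.indicator (fun z => (‖z‖ ^ ((N : ℝ) + 2 * s))⁻¹) z

/-- The total mass of `tailKernel`. -/
noncomputable def tailMass (N : ℕ) (s r : ℝ) : ℝ :=
  ∫ z : EuclideanSpace ℝ (Fin N), tailKernel s r z

lemma tailKernel_nonneg {N : ℕ} (s r : ℝ) (z : EuclideanSpace ℝ (Fin N)) :
    0 ≤ tailKernel s r z :=
  Set.indicator_nonneg (fun _ _ => by positivity) z

lemma tailKernel_neg {N : ℕ} (s r : ℝ) (z : EuclideanSpace ℝ (Fin N)) :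
    tailKernel s r (-z) = tailKernel s r z := by
  simp [tailKernel, Set.indicator]

lemma measurable_tailKernel {N : ℕ} (s r : ℝ) :
    Measurable (tailKernel s r : EuclideanSpace ℝ (Fin N) → ℝ) :=
  Measurable.indicator (by fun_prop) (measurableSet_le measurable_const measurable_norm)

/-- For `‖z‖ ≥ r` one has `1 + ‖z‖ ≤ (1 + r⁻¹) ‖z‖`, so the kernel is dominated by a multiple of `(1
+ ‖z‖) ^ (-(N + 2 s))`, whose decay beats the dimension. -/
lemma integrable_tailKernel {N : ℕ} {s r : ℝ} (hs : 0 < s) (hr : 0 < r) :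
    Integrable (tailKernel s r : EuclideanSpace ℝ (Fin N) → ℝ) := by
  have he : (0 : ℝ) ≤ (N : ℝ) + 2 * s := by positivity
  have h1 : Integrable (fun z : EuclideanSpace ℝ (Fin N) =>
      (1 + r⁻¹) ^ ((N : ℝ) + 2 * s) * (1 + ‖z‖) ^ (-((N : ℝ) + 2 * s))) :=
    (integrable_one_add_norm (by simp [hs])).const_mul _
  refine h1.mono' (measurable_tailKernel s r).aestronglyMeasurable (ae_of_all _ fun z => ?_)
  rw [Real.norm_of_nonneg (tailKernel_nonneg s r z)]
  by_cases hz : r ≤ ‖z‖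
  · have hz0 : 0 < ‖z‖ := hr.trans_le hz
    have hle : 1 + ‖z‖ ≤ (1 + r⁻¹) * ‖z‖ := by
      have : 1 ≤ r⁻¹ * ‖z‖ := by
        rw [inv_mul_eq_div]; exact (one_le_div hr).2 hz
      linarith
    have h2 := Real.rpow_le_rpow (by positivity) hle he
    rw [Real.mul_rpow (by positivity) hz0.le] at h2
    have hA : 0 < (1 + ‖z‖) ^ ((N : ℝ) + 2 * s) := by positivity
    have hB : 0 < ‖z‖ ^ ((N : ℝ) + 2 * s) := by positivity
    simp only [tailKernel, Set.indicator, Set.mem_ofPred_eq, hz, if_true]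
    rw [Real.rpow_neg (by positivity), ← div_eq_mul_inv, inv_eq_one_div, div_le_div_iff₀ hB hA]
    linarith
  · simp only [tailKernel, Set.indicator, Set.mem_ofPred_eq, hz, if_false]
    positivity

lemma tailMass_nonneg (N : ℕ) (s r : ℝ) : 0 ≤ tailMass N s r :=
  integral_nonneg (tailKernel_nonneg s r)

/-- This mass is the Poincaré constant. In dimension zero there is nothing beyond `r` and it would
vanish. -/
lemma tailMass_pos {N : ℕ} (hN : 1 ≤ N) {s r : ℝ} (hs : 0 < s) (hr : 0 < r) :
    0 < tailMass N s r := by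
  have : NeZero N := ⟨by omega⟩
  refine (integral_pos_iff_support_of_nonneg (tailKernel_nonneg s r)
    (integrable_tailKernel hs hr)).2 ?_
  have hopen : IsOpen {z : EuclideanSpace ℝ (Fin N) | r < ‖z‖} :=
    isOpen_lt continuous_const continuous_norm
  obtain ⟨z, hz⟩ := NormedSpace.exists_lt_norm ℝ (EuclideanSpace ℝ (Fin N)) r
  refine (hopen.measure_pos volume ⟨z, hz⟩).trans_le (measure_mono fun z hz => ?_)
  have hz' : r < ‖z‖ := hz
  have hz0 : 0 < ‖z‖ := hr.trans hz'
  simp only [Function.mem_support, tailKernel, Set.indicator, Set.mem_ofPred_eq, hz'.le, if_true]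
  positivity

lemma tendsto_tailMass {N : ℕ} {s : ℝ} (hs : 0 < s) :
    Tendsto (tailMass N s) atTop (𝓝 0) := by
  have h := tendsto_integral_filter_of_dominated_convergence (l := (atTop : Filter ℝ))
    (F := fun r (z : EuclideanSpace ℝ (Fin N)) => tailKernel s r z) (f := fun _ => (0 : ℝ))
    (μ := volume) (tailKernel s 1)
    (Eventually.of_forall fun r => (measurable_tailKernel s r).aestronglyMeasurable)
    ?_ (integrable_tailKernel hs one_pos) ?_
  · rw [integral_zero] at h
    exact h
  · filter_upwards [eventually_ge_atTop 1] with r hr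
    refine ae_of_all _ fun z => ?_
    rw [Real.norm_of_nonneg (tailKernel_nonneg s r z)]
    exact Set.indicator_le_indicator_of_subset (fun z (hz : r ≤ ‖z‖) => hr.trans hz)
      (fun _ => by positivity) z
  · refine ae_of_all _ fun z => tendsto_const_nhds.congr' ?_
    filter_upwards [eventually_gt_atTop ‖z‖] with r hr
    simp [tailKernel, Set.indicator, not_le.2 hr]

/-- The shear `(x, y) ↦ (x, y - x)` preserves measure and separates the variables. -/
lemma integrable_mul_tailKernel_fst {N : ℕ} {s r : ℝ} (hs : 0 < s) (hr : 0 < r)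
    {h : EuclideanSpace ℝ (Fin N) → ℝ} (hh : Integrable h) :
    Integrable (fun p : EuclideanSpace ℝ (Fin N) × EuclideanSpace ℝ (Fin N) =>
      h p.1 * tailKernel s r (p.1 - p.2)) := by
  have h1 := (measurePreserving_prod_sub (volume : Measure (EuclideanSpace ℝ (Fin N)))
    volume).integrable_comp_of_integrable (hh.mul_prod (integrable_tailKernel hs hr))
  refine h1.congr (ae_of_all _ fun p => ?_)
  simp only [Function.comp]
  rw [← tailKernel_neg, neg_sub]

lemma integral_mul_tailKernel_fst {N : ℕ} {s r : ℝ} (h : EuclideanSpace ℝ (Fin N) → ℝ) :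
    ∫ p : EuclideanSpace ℝ (Fin N) × EuclideanSpace ℝ (Fin N),
      h p.1 * tailKernel s r (p.1 - p.2) = (∫ x, h x) * tailMass N s r := by
  have h1 := (measurePreserving_prod_sub (volume : Measure (EuclideanSpace ℝ (Fin N)))
    volume).integral_comp (MeasurableEquiv.shearSubRight _).measurableEmbedding
      (fun p => h p.1 * tailKernel s r p.2)
  rw [integral_prod_mul] at h1
  rw [tailMass, ← h1, Measure.volume_eq_prod]
  refine integral_congr_ae (ae_of_all _ fun p => ?_)
  simp only
  rw [← tailKernel_neg, neg_sub]

lemma integrable_mul_tailKernel_snd {N : ℕ} {s r : ℝ} (hs : 0 < s) (hr : 0 < r)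
    {h : EuclideanSpace ℝ (Fin N) → ℝ} (hh : Integrable h) :
    Integrable (fun p : EuclideanSpace ℝ (Fin N) × EuclideanSpace ℝ (Fin N) =>
      h p.2 * tailKernel s r (p.1 - p.2)) := by
  refine (integrable_mul_tailKernel_fst hs hr hh).swap.congr (ae_of_all _ fun p => ?_)
  simp only [Function.comp, Prod.fst_swap, Prod.snd_swap]
  rw [← tailKernel_neg, neg_sub]

lemma integral_mul_tailKernel_snd {N : ℕ} {s r : ℝ} (h : EuclideanSpace ℝ (Fin N) → ℝ) :
    ∫ p : EuclideanSpace ℝ (Fin N) × EuclideanSpace ℝ (Fin N),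
      h p.2 * tailKernel s r (p.1 - p.2) = (∫ x, h x) * tailMass N s r := by
  rw [← integral_mul_tailKernel_fst, Measure.volume_eq_prod, ← integral_prod_swap]
  refine integral_congr_ae (ae_of_all _ fun p => ?_)
  simp only [Prod.fst_swap, Prod.snd_swap]
  rw [← tailKernel_neg, neg_sub]

/-! ### Energies as `L²` products of difference quotients -/

/-- The difference quotient `(v x - v y) / |x - y|^((N + 2 s) / 2)`. -/
noncomputable def diffQuot {N : ℕ} (s : ℝ) (v : EuclideanSpace ℝ (Fin N) → ℝ)
    (p : EuclideanSpace ℝ (Fin N) × EuclideanSpace ℝ (Fin N)) : ℝ :=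
  (v p.1 - v p.2) / ‖p.1 - p.2‖ ^ (((N : ℝ) + 2 * s) / 2)

lemma rpow_half_mul_self {a e : ℝ} (ha : 0 ≤ a) (he : 0 ≤ e) :
    a ^ (e / 2) * a ^ (e / 2) = a ^ e := by
  rw [← Real.rpow_add_of_nonneg ha (by positivity) (by positivity), add_halves]

lemma diffQuot_mul_diffQuot {N : ℕ} {s : ℝ} (hs : 0 < s) (u v : EuclideanSpace ℝ (Fin N) → ℝ)
    (p : EuclideanSpace ℝ (Fin N) × EuclideanSpace ℝ (Fin N)) :
    diffQuot s u p * diffQuot s v p =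
      ((u p.1 - u p.2) * (v p.1 - v p.2)) / ‖p.1 - p.2‖ ^ ((N : ℝ) + 2 * s) := by
  rw [diffQuot, diffQuot, div_mul_div_comm, rpow_half_mul_self (norm_nonneg _) (by positivity)]

lemma gagliardoForm_eq {N : ℕ} {s : ℝ} (hs : 0 < s)
    (D : Set (EuclideanSpace ℝ (Fin N) × EuclideanSpace ℝ (Fin N)))
    (u v : EuclideanSpace ℝ (Fin N) → ℝ) :
    gagliardoForm s D u v = ∫ p in D, diffQuot s u p * diffQuot s v p := by
  simp only [gagliardoForm, diffQuot_mul_diffQuot hs]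

lemma gagliardoEnergy_eq {N : ℕ} {s : ℝ} (hs : 0 < s)
    (D : Set (EuclideanSpace ℝ (Fin N) × EuclideanSpace ℝ (Fin N)))
    (v : EuclideanSpace ℝ (Fin N) → ℝ) :
    gagliardoEnergy s D v = ∫⁻ p in D, ENNReal.ofReal (diffQuot s v p ^ 2) := by
  simp only [gagliardoEnergy, sq (diffQuot s v _), diffQuot_mul_diffQuot hs, sq_abs, ← sq (v _ - v _)]

lemma measurable_norm_rpow_sub {N : ℕ} (e : ℝ) :
    Measurable (fun p : EuclideanSpace ℝ (Fin N) × EuclideanSpace ℝ (Fin N) =>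
      ‖p.1 - p.2‖ ^ e) := by
  fun_prop

lemma aestronglyMeasurable_diffQuot {N : ℕ} {s : ℝ} {v : EuclideanSpace ℝ (Fin N) → ℝ}
    (hv : AEStronglyMeasurable v) : AEStronglyMeasurable (diffQuot s v) := by
  have h1 : AEMeasurable (fun p : EuclideanSpace ℝ (Fin N) × EuclideanSpace ℝ (Fin N) => v p.1) :=
    hv.comp_fst.aemeasurable
  have h2 : AEMeasurable (fun p : EuclideanSpace ℝ (Fin N) × EuclideanSpace ℝ (Fin N) => v p.2) :=
    hv.comp_snd.aemeasurable
  exact ((h1.sub h2).div (measurable_norm_rpow_sub _).aemeasurable).aestronglyMeasurable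

lemma memLp_diffQuot_iff {N : ℕ} {s : ℝ} (hs : 0 < s) {v : EuclideanSpace ℝ (Fin N) → ℝ}
    (hv : AEStronglyMeasurable v)
    (D : Set (EuclideanSpace ℝ (Fin N) × EuclideanSpace ℝ (Fin N))) :
    MemLp (diffQuot s v) 2 (volume.restrict D) ↔ gagliardoEnergy s D v < ∞ := by
  have hm : AEStronglyMeasurable (diffQuot s v) (volume.restrict D) :=
    (aestronglyMeasurable_diffQuot hv).restrict
  rw [memLp_two_iff_integrable_sq hm, gagliardoEnergy_eq hs, Integrable,
    hasFiniteIntegral_iff_ofReal (ae_of_all _ fun _ => sq_nonneg _)]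
  exact and_iff_right (hm.pow 2)

lemma ae_comp_fst_snd {N : ℕ} {P : EuclideanSpace ℝ (Fin N) → Prop} (h : ∀ᵐ x, P x) :
    ∀ᵐ p : EuclideanSpace ℝ (Fin N) × EuclideanSpace ℝ (Fin N), P p.1 ∧ P p.2 :=
  (Measure.quasiMeasurePreserving_fst.ae h).and (Measure.quasiMeasurePreserving_snd.ae h)

lemma diffQuot_congr_ae {N : ℕ} {s : ℝ} {u v : EuclideanSpace ℝ (Fin N) → ℝ} (h : u =ᵐ[volume] v) :
    diffQuot s u =ᵐ[volume] diffQuot s v := by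
  filter_upwards [ae_comp_fst_snd h] with p hp
  simp only [diffQuot, hp.1, hp.2]

lemma diffQuot_sub {N : ℕ} (s : ℝ) (u v : EuclideanSpace ℝ (Fin N) → ℝ) :
    diffQuot s (u - v) = diffQuot s u - diffQuot s v := by
  ext p; simp only [diffQuot, Pi.sub_apply]; ring

lemma diffQuot_add {N : ℕ} (s : ℝ) (u v : EuclideanSpace ℝ (Fin N) → ℝ) :
    diffQuot s (u + v) = diffQuot s u + diffQuot s v := by
  ext p; simp only [diffQuot, Pi.add_apply]; ring

lemma diffQuot_smul {N : ℕ} (s c : ℝ) (v : EuclideanSpace ℝ (Fin N) → ℝ) :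
    diffQuot s (c • v) = c • diffQuot s v := by
  ext p; simp only [diffQuot, Pi.smul_apply, smul_eq_mul]; ring

/-! ### Representatives vanishing off `Ω` -/

/-- Pointwise representatives of elements of `𝓗_0^s(Ω)` that vanish everywhere outside `Ω`. -/
structure IsAdmissible {N : ℕ} (s : ℝ) (Ω : Set (EuclideanSpace ℝ (Fin N)))
    (v : EuclideanSpace ℝ (Fin N) → ℝ) : Prop where
  memLp : MemLp v 2
  memLp_diffQuot : MemLp (diffQuot s v) 2
  eq_zero : ∀ x ∉ Ω, v x = 0

namespace IsAdmissible

variable {N : ℕ} {s : ℝ} {Ω : Set (EuclideanSpace ℝ (Fin N))}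
  {u v : EuclideanSpace ℝ (Fin N) → ℝ}

lemma sub (hu : IsAdmissible s Ω u) (hv : IsAdmissible s Ω v) : IsAdmissible s Ω (u - v) where
  memLp := hu.memLp.sub hv.memLp
  memLp_diffQuot := by rw [diffQuot_sub]; exact hu.memLp_diffQuot.sub hv.memLp_diffQuot
  eq_zero x hx := by simp [hu.eq_zero x hx, hv.eq_zero x hx]

lemma add (hu : IsAdmissible s Ω u) (hv : IsAdmissible s Ω v) : IsAdmissible s Ω (u + v) where
  memLp := hu.memLp.add hv.memLp
  memLp_diffQuot := by rw [diffQuot_add]; exact hu.memLp_diffQuot.add hv.memLp_diffQuot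
  eq_zero x hx := by simp [hu.eq_zero x hx, hv.eq_zero x hx]

lemma smul (c : ℝ) (hv : IsAdmissible s Ω v) : IsAdmissible s Ω (c • v) where
  memLp := hv.memLp.const_smul c
  memLp_diffQuot := by rw [diffQuot_smul]; exact hv.memLp_diffQuot.const_smul c
  eq_zero x hx := by simp [hv.eq_zero x hx]

lemma zero : IsAdmissible s Ω (0 : EuclideanSpace ℝ (Fin N) → ℝ) where
  memLp := MemLp.zero
  memLp_diffQuot := by
    have : diffQuot s (0 : EuclideanSpace ℝ (Fin N) → ℝ) = 0 := by ext p; simp [diffQuot]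
    rw [this]; exact MemLp.zero
  eq_zero x _ := rfl

lemma memFracEnergySpace (hs : 0 < s) (hΩ : MeasurableSet Ω) (hv : IsAdmissible s Ω v) :
    MemFracEnergySpace s Ω v where
  memLp := hv.memLp
  energy_lt_top := by
    rw [← memLp_diffQuot_iff hs hv.memLp.1, Measure.restrict_univ]; exact hv.memLp_diffQuot
  ae_zero := (ae_restrict_iff' hΩ.compl).2 (ae_of_all _ hv.eq_zero)

lemma integrable_mul (hu : IsAdmissible s Ω u) (hv : IsAdmissible s Ω v) :
    Integrable (fun x => u x * v x) :=
  hu.memLp.integrable_mul hv.memLp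

lemma integrable_diffQuot_mul (hu : IsAdmissible s Ω u) (hv : IsAdmissible s Ω v) :
    Integrable (fun p => diffQuot s u p * diffQuot s v p) :=
  hu.memLp_diffQuot.integrable_mul hv.memLp_diffQuot

end IsAdmissible

lemma MemFracEnergySpace.ae_eq_indicator {N : ℕ} {s : ℝ} {Ω : Set (EuclideanSpace ℝ (Fin N))}
    {v : EuclideanSpace ℝ (Fin N) → ℝ} (hΩ : MeasurableSet Ω) (hv : MemFracEnergySpace s Ω v) :
    v =ᵐ[volume] Ω.indicator v := by
  filter_upwards [(ae_restrict_iff' hΩ.compl).1 hv.ae_zero] with x hx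
  by_cases h : x ∈ Ω
  · simp [h]
  · simp [h, hx h]

lemma MemFracEnergySpace.isAdmissible_indicator {N : ℕ} {s : ℝ}
    {Ω : Set (EuclideanSpace ℝ (Fin N))} {v : EuclideanSpace ℝ (Fin N) → ℝ} (hs : 0 < s)
    (hΩ : MeasurableSet Ω) (hv : MemFracEnergySpace s Ω v) :
    IsAdmissible s Ω (Ω.indicator v) where
  memLp := (memLp_congr_ae (hv.ae_eq_indicator hΩ)).1 hv.memLp
  memLp_diffQuot := by
    refine (memLp_congr_ae (diffQuot_congr_ae (hv.ae_eq_indicator hΩ))).1 ?_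
    rw [← Measure.restrict_univ (μ := volume), memLp_diffQuot_iff hs hv.memLp.1]
    exact hv.energy_lt_top
  eq_zero x hx := Set.indicator_of_notMem hx v

lemma gagliardoForm_univ_congr_ae {N : ℕ} {s : ℝ} (hs : 0 < s)
    {u u' v v' : EuclideanSpace ℝ (Fin N) → ℝ} (hu : u =ᵐ[volume] u') (hv : v =ᵐ[volume] v') :
    gagliardoForm s Set.univ u v = gagliardoForm s Set.univ u' v' := by
  rw [gagliardoForm_eq hs, gagliardoForm_eq hs, Measure.restrict_univ]
  refine integral_congr_ae ?_
  filter_upwards [diffQuot_congr_ae (s := s) hu, diffQuot_congr_ae (s := s) hv] with p h1 h2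
  rw [h1, h2]

/-! ### The interaction region and the tail identity -/

lemma completedDomain_eq_thickening {N : ℕ} {δ : ℝ} (hδ : 0 < δ)
    (Ω : Set (EuclideanSpace ℝ (Fin N))) : completedDomain δ Ω = Metric.thickening δ Ω := by
  ext y
  simp only [completedDomain, nonlocalBoundary, Metric.mem_thickening_iff, Set.mem_union,
    Set.mem_ofPred_eq, dist_comm y, dist_eq_norm]
  constructor
  · rintro (h | ⟨-, h⟩)
    · exact ⟨y, h, by simpa using hδ⟩
    · exact h
  · intro h
    by_cases hy : y ∈ Ω
    · exact Or.inl hy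
    · exact Or.inr ⟨hy, h⟩

lemma measurableSet_completedDomain {N : ℕ} {δ : ℝ} (hδ : 0 < δ)
    (Ω : Set (EuclideanSpace ℝ (Fin N))) : MeasurableSet (completedDomain δ Ω) := by
  rw [completedDomain_eq_thickening hδ]
  exact Metric.isOpen_thickening.measurableSet

lemma mem_interactionRegion {N : ℕ} {δ : ℝ} {Ω : Set (EuclideanSpace ℝ (Fin N))}
    {p : EuclideanSpace ℝ (Fin N) × EuclideanSpace ℝ (Fin N)} :
    p ∈ interactionRegion δ Ω ↔
      p.1 ∈ completedDomain δ Ω ∧ p.2 ∈ completedDomain δ Ω ∧ ‖p.1 - p.2‖ < δ := by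
  simp only [interactionRegion, Set.mem_ofPred_eq, Set.mem_inter_iff, Metric.mem_ball,
    dist_eq_norm, norm_sub_rev p.2]

lemma measurableSet_interactionRegion {N : ℕ} {δ : ℝ} (hδ : 0 < δ)
    (Ω : Set (EuclideanSpace ℝ (Fin N))) : MeasurableSet (interactionRegion δ Ω) := by
  have h : interactionRegion δ Ω = (completedDomain δ Ω ×ˢ completedDomain δ Ω) ∩
      {p | ‖p.1 - p.2‖ < δ} := by
    ext p; simp [mem_interactionRegion, and_assoc]
  rw [h]
  exact ((measurableSet_completedDomain hδ Ω).prod (measurableSet_completedDomain hδ Ω)).inter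
    (measurableSet_lt (by fun_prop) measurable_const)

lemma mem_interactionRegion_of_fst_mem {N : ℕ} {δ : ℝ} {Ω : Set (EuclideanSpace ℝ (Fin N))}
    {p : EuclideanSpace ℝ (Fin N) × EuclideanSpace ℝ (Fin N)} (h1 : p.1 ∈ Ω)
    (h : ‖p.1 - p.2‖ < δ) : p ∈ interactionRegion δ Ω := by
  refine mem_interactionRegion.2 ⟨Or.inl h1, ?_, h⟩
  by_cases h2 : p.2 ∈ Ω
  · exact Or.inl h2
  · exact Or.inr ⟨h2, p.1, h1, h⟩

lemma mem_interactionRegion_of_snd_mem {N : ℕ} {δ : ℝ} {Ω : Set (EuclideanSpace ℝ (Fin N))}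
    {p : EuclideanSpace ℝ (Fin N) × EuclideanSpace ℝ (Fin N)} (h2 : p.2 ∈ Ω)
    (h : ‖p.1 - p.2‖ < δ) : p ∈ interactionRegion δ Ω := by
  have h' := mem_interactionRegion.1 (mem_interactionRegion_of_fst_mem (p := p.swap) h2
    (by rwa [Prod.fst_swap, Prod.snd_swap, norm_sub_rev]))
  exact mem_interactionRegion.2 ⟨h'.2.1, h'.1, h⟩

/-- If the horizon exceeds the diameter of `Ω`, the interactions that it cuts off reduce to a
multiple of the zeroth order term. -/
lemma diffQuot_mul_eq_indicator_add_tail {N : ℕ} {s δ : ℝ} (hs : 0 < s)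
    {Ω : Set (EuclideanSpace ℝ (Fin N))} (hΩδ : ∀ x ∈ Ω, ∀ y ∈ Ω, ‖x - y‖ < δ)
    {u v : EuclideanSpace ℝ (Fin N) → ℝ} (hu : ∀ x ∉ Ω, u x = 0) (hv : ∀ x ∉ Ω, v x = 0)
    (p : EuclideanSpace ℝ (Fin N) × EuclideanSpace ℝ (Fin N)) :
    diffQuot s u p * diffQuot s v p =
      (interactionRegion δ Ω).indicator (fun p => diffQuot s u p * diffQuot s v p) p +
        (u p.1 * v p.1 * tailKernel s δ (p.1 - p.2) +
          u p.2 * v p.2 * tailKernel s δ (p.1 - p.2)) := by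
  by_cases hlt : ‖p.1 - p.2‖ < δ
  · have ht : tailKernel s δ (p.1 - p.2) = 0 := by
      simp [tailKernel, Set.indicator, not_le.2 hlt]
    rw [ht]
    by_cases hp : p ∈ interactionRegion δ Ω
    · simp [hp]
    · have h1 : p.1 ∉ Ω := fun h => hp (mem_interactionRegion_of_fst_mem h hlt)
      have h2 : p.2 ∉ Ω := fun h => hp (mem_interactionRegion_of_snd_mem h hlt)
      simp [hp, diffQuot, hu _ h1, hu _ h2]
  · have hp : p ∉ interactionRegion δ Ω := fun h => hlt (mem_interactionRegion.1 h).2.2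
    have ht : tailKernel s δ (p.1 - p.2) = (‖p.1 - p.2‖ ^ ((N : ℝ) + 2 * s))⁻¹ := by
      simp [tailKernel, Set.indicator, not_lt.1 hlt]
    rw [ht, Set.indicator_of_notMem hp, diffQuot_mul_diffQuot hs]
    by_cases h1 : p.1 ∈ Ω
    · have h2 : p.2 ∉ Ω := fun h => hlt (hΩδ _ h1 _ h)
      rw [hu _ h2, hv _ h2]; ring
    · rw [hu _ h1, hv _ h1]; ring

lemma setIntegral_interactionRegion_add_tail {N : ℕ} {s δ : ℝ} (hs : 0 < s) (hδ : 0 < δ)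
    {Ω : Set (EuclideanSpace ℝ (Fin N))} (hΩδ : ∀ x ∈ Ω, ∀ y ∈ Ω, ‖x - y‖ < δ)
    {u v : EuclideanSpace ℝ (Fin N) → ℝ} (hu : IsAdmissible s Ω u) (hv : IsAdmissible s Ω v) :
    ∫ p, diffQuot s u p * diffQuot s v p =
      (∫ p in interactionRegion δ Ω, diffQuot s u p * diffQuot s v p) +
        2 * tailMass N s δ * ∫ x, u x * v x := by
  have huv := hu.integrable_mul hv
  have hD := measurableSet_interactionRegion hδ Ω
  have h1 := integrable_mul_tailKernel_fst hs hδ huv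
  have h2 := integrable_mul_tailKernel_snd hs hδ huv
  rw [integral_congr_ae (ae_of_all _ (diffQuot_mul_eq_indicator_add_tail hs hΩδ hu.eq_zero
    hv.eq_zero)), integral_add ((hu.integrable_diffQuot_mul hv).indicator hD) (by exact h1.add h2),
    integral_indicator hD, integral_add h1 h2,
    integral_mul_tailKernel_fst (fun x => u x * v x),
    integral_mul_tailKernel_snd (fun x => u x * v x)]
  ring

/-! ### Poincaré inequality and comparison of the energy spaces -/

/-- The fractional Poincaré inequality. -/
lemma IsAdmissible.poincare {N : ℕ} {s R : ℝ} (hs : 0 < s) (hR : 0 < R)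
    {Ω : Set (EuclideanSpace ℝ (Fin N))} (hΩR : ∀ x ∈ Ω, ∀ y ∈ Ω, ‖x - y‖ < R)
    {v : EuclideanSpace ℝ (Fin N) → ℝ} (hv : IsAdmissible s Ω v) :
    tailMass N s R * ∫ x, v x * v x ≤ ∫ p, diffQuot s v p * diffQuot s v p := by
  rw [setIntegral_interactionRegion_add_tail hs hR hΩR hv hv]
  have h1 : 0 ≤ ∫ p in interactionRegion R Ω, diffQuot s v p * diffQuot s v p :=
    integral_nonneg fun p => mul_self_nonneg _
  have h2 : 0 ≤ tailMass N s R * ∫ x, v x * v x :=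
    mul_nonneg (tailMass_nonneg N s R) (integral_nonneg fun x => mul_self_nonneg _)
  linarith

lemma MemEnergySpace.ae_eq_indicator {N : ℕ} {δ s : ℝ} (hδ : 0 < δ)
    {Ω : Set (EuclideanSpace ℝ (Fin N))} (hΩ : MeasurableSet Ω)
    {v : EuclideanSpace ℝ (Fin N) → ℝ} (hv : MemEnergySpace δ s Ω v) :
    ∀ᵐ x, x ∈ completedDomain δ Ω → v x = Ω.indicator v x := by
  have hB : MeasurableSet (nonlocalBoundary δ Ω) := by
    have : nonlocalBoundary δ Ω = completedDomain δ Ω \ Ω := by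
      ext x; simp only [completedDomain, nonlocalBoundary, Set.mem_sdiff, Set.mem_union,
        Set.mem_ofPred_eq]; tauto
    rw [this]; exact (measurableSet_completedDomain hδ Ω).diff hΩ
  filter_upwards [(ae_restrict_iff' hB).1 hv.ae_zero] with x hx hxD
  by_cases h : x ∈ Ω
  · simp [h]
  · simp [h, hx (hxD.resolve_left h)]

lemma diffQuot_ae_eq_of_ae_eq_on_completedDomain {N : ℕ} {δ s : ℝ} (hδ : 0 < δ)
    {Ω : Set (EuclideanSpace ℝ (Fin N))} {v w : EuclideanSpace ℝ (Fin N) → ℝ}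
    (h : ∀ᵐ x, x ∈ completedDomain δ Ω → v x = w x) :
    diffQuot s v =ᵐ[volume.restrict (interactionRegion δ Ω)] diffQuot s w := by
  refine (ae_restrict_iff' (measurableSet_interactionRegion hδ Ω)).2 ?_
  filter_upwards [ae_comp_fst_snd h] with p hp hpD
  have hpD' := mem_interactionRegion.1 hpD
  simp only [diffQuot, hp.1 hpD'.1, hp.2 hpD'.2.1]

/-- The energy missing from the truncated one is a tail term, finite because `v` is square
integrable on `Ω`. -/
lemma MemEnergySpace.isAdmissible_indicator {N : ℕ} {δ s : ℝ} (hs : 0 < s) (hδ : 0 < δ)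
    {Ω : Set (EuclideanSpace ℝ (Fin N))} (hΩ : MeasurableSet Ω)
    (hΩδ : ∀ x ∈ Ω, ∀ y ∈ Ω, ‖x - y‖ < δ)
    {v : EuclideanSpace ℝ (Fin N) → ℝ} (hv : MemEnergySpace δ s Ω v) :
    IsAdmissible s Ω (Ω.indicator v) := by
  have h0 : ∀ x ∉ Ω, Ω.indicator v x = 0 := fun x hx => Set.indicator_of_notMem hx v
  have hL : MemLp (Ω.indicator v) 2 := (memLp_indicator_iff_restrict hΩ).2
    (hv.memLp.mono_measure (Measure.restrict_mono Set.subset_union_left le_rfl))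
  refine ⟨hL, ?_, h0⟩
  have hD := measurableSet_interactionRegion hδ Ω
  have hDint : MemLp (diffQuot s (Ω.indicator v)) 2 (volume.restrict (interactionRegion δ Ω)) := by
    rw [memLp_diffQuot_iff hs hL.1]
    refine lt_of_eq_of_lt ?_ hv.energy_lt_top
    rw [gagliardoEnergy_eq hs, gagliardoEnergy_eq hs]
    refine lintegral_congr_ae ?_
    filter_upwards [diffQuot_ae_eq_of_ae_eq_on_completedDomain (s := s) hδ
      (hv.ae_eq_indicator hδ hΩ)] with p hp
    rw [hp]
  have hvv : Integrable (fun x => Ω.indicator v x * Ω.indicator v x) := hL.integrable_mul hL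
  rw [memLp_two_iff_integrable_sq (aestronglyMeasurable_diffQuot hL.1)]
  have hI := (((integrable_indicator_iff hD).2 (hDint.integrable_mul hDint)).add
    ((integrable_mul_tailKernel_fst hs hδ hvv).add (integrable_mul_tailKernel_snd hs hδ hvv)))
  refine hI.congr (ae_of_all _ fun p => ?_)
  refine Eq.trans ?_ (sq _).symm
  exact (diffQuot_mul_eq_indicator_add_tail hs hΩδ h0 h0 p).symm

/-- Values of `u` off the completed domain are arbitrary, so only its indicator can enter the full
form. -/
lemma gagliardoForm_interactionRegion_eq {N : ℕ} {δ s : ℝ} (hs : 0 < s) (hδ : 0 < δ)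
    {Ω : Set (EuclideanSpace ℝ (Fin N))} (hΩ : MeasurableSet Ω)
    (hΩδ : ∀ x ∈ Ω, ∀ y ∈ Ω, ‖x - y‖ < δ) {u v : EuclideanSpace ℝ (Fin N) → ℝ}
    (hu : MemEnergySpace δ s Ω u) (hv : IsAdmissible s Ω v) :
    gagliardoForm s (interactionRegion δ Ω) u v =
      (∫ p, diffQuot s (Ω.indicator u) p * diffQuot s v p) -
        2 * tailMass N s δ * ∫ x, Ω.indicator u x * v x := by
  rw [setIntegral_interactionRegion_add_tail hs hδ hΩδ
    (hu.isAdmissible_indicator hs hδ hΩ hΩδ) hv, gagliardoForm_eq hs, add_sub_cancel_right]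
  refine integral_congr_ae ?_
  filter_upwards [diffQuot_ae_eq_of_ae_eq_on_completedDomain (s := s) hδ
      (hu.ae_eq_indicator hδ hΩ)] with p hp
  rw [hp]

lemma MemFracEnergySpace.memEnergySpace {N : ℕ} {s : ℝ} (δ : ℝ)
    {Ω : Set (EuclideanSpace ℝ (Fin N))} {v : EuclideanSpace ℝ (Fin N) → ℝ}
    (hv : MemFracEnergySpace s Ω v) : MemEnergySpace δ s Ω v where
  memLp := hv.memLp.restrict _
  energy_lt_top := (lintegral_mono_set (Set.subset_univ _)).trans_lt hv.energy_lt_top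
  ae_zero := ae_mono (Measure.restrict_mono (fun _ hx => hx.1) le_rfl) hv.ae_zero

/-! ### Existence for the fractional problem -/

/-- The equation of `IsFracWeakSolution` for representatives that vanish outside `Ω`. -/
lemma isFracWeakSolution_iff {N : ℕ} {s : ℝ} (hs : 0 < s) {Ω : Set (EuclideanSpace ℝ (Fin N))}
    (hΩ : MeasurableSet Ω) {f u : EuclideanSpace ℝ (Fin N) → ℝ} (hu : IsAdmissible s Ω u) :
    IsFracWeakSolution s Ω f u ↔ ∀ v, IsAdmissible s Ω v →
      fracConst N s / 2 * ∫ p, diffQuot s u p * diffQuot s v p = ∫ x in Ω, f x * v x := by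
  constructor
  · intro h v hv
    rw [← h.eq v (hv.memFracEnergySpace hs hΩ), gagliardoForm_eq hs, Measure.restrict_univ]
  · refine fun h => ⟨hu.memFracEnergySpace hs hΩ, fun v hv => ?_⟩
    rw [gagliardoForm_univ_congr_ae hs (ae_eq_refl u) (hv.ae_eq_indicator hΩ),
      gagliardoForm_eq hs, Measure.restrict_univ, h _ (hv.isAdmissible_indicator hs hΩ)]
    exact setIntegral_congr_fun hΩ fun x hx => by simp [hx]

lemma fracConst_pos {N : ℕ} {s : ℝ} (hs0 : 0 < s) (hs1 : s < 1) : 0 < fracConst N s := by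
  have h1 : 0 < Real.Gamma ((N : ℝ) / 2 + s) := Real.Gamma_pos_of_pos (by positivity)
  have h2 : 0 < Real.Gamma (1 - s) := Real.Gamma_pos_of_pos (by linarith)
  rw [fracConst]
  positivity

lemma inner_toLp_eq_integral_mul {α : Type*} [MeasurableSpace α] {μ : Measure α} {u v : α → ℝ}
    (hu : MemLp u 2 μ) (hv : MemLp v 2 μ) :
    inner ℝ (hu.toLp u) (hv.toLp v) = ∫ x, u x * v x ∂μ := by
  rw [L2.inner_def]
  refine integral_congr_ae ?_
  filter_upwards [hu.coeFn_toLp, hv.coeFn_toLp] with x h1 h2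
  rw [h1, h2, real_inner_eq_re_inner, RCLike.inner_apply]
  simp [mul_comm]

lemma norm_toLp_sq_eq_integral_mul {α : Type*} [MeasurableSpace α] {μ : Measure α} {u : α → ℝ}
    (hu : MemLp u 2 μ) : ‖hu.toLp u‖ ^ 2 = ∫ x, u x * u x ∂μ := by
  rw [← real_inner_self_eq_norm_sq, inner_toLp_eq_integral_mul]

/-- The difference quotients of the elements of `𝓗_0^s(Ω)`, as a subspace of `L²`. -/
noncomputable def diffQuotSpace {N : ℕ} (s : ℝ) (Ω : Set (EuclideanSpace ℝ (Fin N))) :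
    Submodule ℝ (Lp ℝ 2 (volume : Measure (EuclideanSpace ℝ (Fin N) × EuclideanSpace ℝ (Fin N))))
    where
  carrier := {g | ∃ v, IsAdmissible s Ω v ∧ g =ᵐ[volume] diffQuot s v}
  add_mem' := by
    rintro a b ⟨u, hu, hau⟩ ⟨v, hv, hbv⟩
    refine ⟨u + v, hu.add hv, (Lp.coeFn_add a b).trans ?_⟩
    rw [diffQuot_add]
    exact hau.add hbv
  zero_mem' := by
    refine ⟨0, .zero, (Lp.coeFn_zero _ _ _).trans (ae_of_all _ fun p => ?_)⟩
    simp [diffQuot]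
  smul_mem' := by
    rintro c a ⟨u, hu, hau⟩
    refine ⟨c • u, hu.smul c, (Lp.coeFn_smul c a).trans ?_⟩
    rw [diffQuot_smul]
    exact hau.const_smul c

/-- By Poincaré, convergence of the quotients makes the functions themselves Cauchy in `L²`; almost
everywhere limits along a subsequence identify the limit quotient. -/
lemma isClosed_diffQuotSpace {N : ℕ} (hN : 1 ≤ N) {s R : ℝ} (hs : 0 < s) (hR : 0 < R)
    {Ω : Set (EuclideanSpace ℝ (Fin N))} (hΩ : MeasurableSet Ω)
    (hΩR : ∀ x ∈ Ω, ∀ y ∈ Ω, ‖x - y‖ < R) :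
    IsClosed (diffQuotSpace s Ω : Set (Lp ℝ 2 (volume :
      Measure (EuclideanSpace ℝ (Fin N) × EuclideanSpace ℝ (Fin N))))) := by
  refine IsSeqClosed.isClosed fun g g' hg hlim => ?_
  choose v hv hgv using hg
  have hκ := tailMass_pos hN hs hR
  have hgn : ∀ n, g n = (hv n).memLp_diffQuot.toLp _ := fun n =>
    Lp.ext ((hgv n).trans (hv n).memLp_diffQuot.coeFn_toLp.symm)
  have hbound : ∀ m n, dist ((hv m).memLp.toLp (v m)) ((hv n).memLp.toLp (v n)) ≤
      √(tailMass N s R)⁻¹ * dist (g m) (g n) := by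
    intro m n
    have h := ((hv m).sub (hv n)).poincare hs hR hΩR
    rw [← norm_toLp_sq_eq_integral_mul ((hv m).sub (hv n)).memLp,
      ← norm_toLp_sq_eq_integral_mul ((hv m).sub (hv n)).memLp_diffQuot] at h
    have hq : MemLp.toLp _ ((hv m).sub (hv n)).memLp_diffQuot = g m - g n := by
      rw [hgn m, hgn n, ← MemLp.toLp_sub]
      exact MemLp.toLp_congr _ _ (ae_of_all _ fun p => by rw [diffQuot_sub])
    rw [hq, MemLp.toLp_sub (hv m).memLp (hv n).memLp] at h
    rw [dist_eq_norm, dist_eq_norm]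
    refine abs_le_of_sq_le_sq' ?_ (by positivity) |>.2
    rw [mul_pow, Real.sq_sqrt (by positivity), inv_mul_eq_div, le_div_iff₀ hκ, mul_comm]
    exact h
  have hcau : CauchySeq fun n => (hv n).memLp.toLp (v n) := by
    rw [cauchySeq_iff_tendsto_dist_atTop_0]
    have h1 := (cauchySeq_iff_tendsto_dist_atTop_0.1 hlim.cauchySeq).const_mul
      √(tailMass N s R)⁻¹
    rw [mul_zero] at h1
    exact squeeze_zero (fun _ => dist_nonneg) (fun p => hbound p.1 p.2) h1
  obtain ⟨V, hV⟩ := cauchySeq_tendsto_of_complete hcau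
  obtain ⟨φ, hφ, hφV⟩ := (tendstoInMeasure_of_tendsto_Lp hV).exists_seq_tendsto_ae
  obtain ⟨ψ, hψ, hψg⟩ := (tendstoInMeasure_of_tendsto_Lp
    (hlim.comp hφ.tendsto_atTop)).exists_seq_tendsto_ae
  -- `V` is only an `L²` class, so its indicator is used to have exact vanishing off `Ω`.
  have hvV : ∀ᵐ x, Tendsto (fun n => v (φ (ψ n)) x) atTop (𝓝 (Ω.indicator V x)) := by
    filter_upwards [hφV, ae_all_iff.2 fun n => (hv n).memLp.coeFn_toLp] with x hx hxn
    by_cases hxΩ : x ∈ Ω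
    · rw [Set.indicator_of_mem hxΩ]
      refine (hx.comp hψ.tendsto_atTop).congr fun n => ?_
      simp [hxn]
    · rw [Set.indicator_of_notMem hxΩ]
      exact tendsto_const_nhds.congr fun n => ((hv _).eq_zero x hxΩ).symm
  have hgV : g' =ᵐ[volume] diffQuot s (Ω.indicator V) := by
    filter_upwards [hψg, ae_comp_fst_snd hvV, ae_all_iff.2 hgv] with p h1 h2 h3
    refine tendsto_nhds_unique h1 (((h2.1.sub h2.2).div_const _).congr fun n => ?_)
    simp only [Function.comp]
    rw [h3, diffQuot]
  refine ⟨Ω.indicator V, ⟨(Lp.memLp V).indicator hΩ, (memLp_congr_ae hgV).1 (Lp.memLp g'),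
    fun x hx => Set.indicator_of_notMem hx _⟩, hgV⟩

/-- When `x ∈ Ω` and `‖x - y‖ ≥ R`, `v y = 0` and the quotient is `v x` times the root of the
kernel. Integrated, this writes `κ(R) ∫ f v` as an `L²` product with the quotient of `v`. -/
lemma mul_sqrt_tailKernel_mul_diffQuot {N : ℕ} {s R : ℝ} (hs : 0 < s)
    {Ω : Set (EuclideanSpace ℝ (Fin N))} (hΩR : ∀ x ∈ Ω, ∀ y ∈ Ω, ‖x - y‖ < R)
    {f v : EuclideanSpace ℝ (Fin N) → ℝ} (hf : ∀ x ∉ Ω, f x = 0) (hv : ∀ x ∉ Ω, v x = 0)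
    (p : EuclideanSpace ℝ (Fin N) × EuclideanSpace ℝ (Fin N)) :
    f p.1 * √(tailKernel s R (p.1 - p.2)) * diffQuot s v p =
      f p.1 * v p.1 * tailKernel s R (p.1 - p.2) := by
  by_cases h1 : p.1 ∈ Ω
  · by_cases hR : R ≤ ‖p.1 - p.2‖
    · have h2 : p.2 ∉ Ω := fun h => (hΩR _ h1 _ h).not_ge hR
      have ht : tailKernel s R (p.1 - p.2) = (‖p.1 - p.2‖ ^ ((N : ℝ) + 2 * s))⁻¹ := by
        simp [tailKernel, Set.indicator, hR]
      rw [ht, diffQuot, hv _ h2, ← rpow_half_mul_self (norm_nonneg _) (by positivity), mul_inv,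
        Real.sqrt_mul_self (by positivity)]
      ring
    · simp [tailKernel, Set.indicator, hR]
  · simp [hf _ h1]

/-- The functional `v ↦ κ(R) ∫ f v` is pairing with an explicit `F` in `L²`; the projection of `F`
onto the quotients represents it, and dividing by `κ(R)` gives `u`. -/
lemma exists_isAdmissible_integral_diffQuot_eq {N : ℕ} (hN : 1 ≤ N) {s R : ℝ} (hs : 0 < s)
    (hR : 0 < R) {Ω : Set (EuclideanSpace ℝ (Fin N))} (hΩ : MeasurableSet Ω)
    (hΩR : ∀ x ∈ Ω, ∀ y ∈ Ω, ‖x - y‖ < R) {f : EuclideanSpace ℝ (Fin N) → ℝ}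
    (hf : MemLp f 2) (hf0 : ∀ x ∉ Ω, f x = 0) :
    ∃ u, IsAdmissible s Ω u ∧ ∀ v, IsAdmissible s Ω v →
      ∫ p, diffQuot s u p * diffQuot s v p = ∫ x, f x * v x := by
  have hκ := tailMass_pos hN hs hR
  set F : EuclideanSpace ℝ (Fin N) × EuclideanSpace ℝ (Fin N) → ℝ :=
    fun p => f p.1 * √(tailKernel s R (p.1 - p.2)) with hF
  have hFm : AEStronglyMeasurable F := by
    refine (AEStronglyMeasurable.comp_fst hf.1).mul ?_
    exact (((measurable_tailKernel s R).comp
      (measurable_fst.sub measurable_snd)).sqrt).aestronglyMeasurable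
  have hFL : MemLp F 2 := by
    rw [memLp_two_iff_integrable_sq hFm]
    refine (integrable_mul_tailKernel_fst hs hR hf.integrable_sq).congr (ae_of_all _ fun p => ?_)
    simp only [hF]
    rw [mul_pow, Real.sq_sqrt (tailKernel_nonneg s R _)]
  have hcomp : IsComplete (diffQuotSpace s Ω : Set (Lp ℝ 2 (volume :
      Measure (EuclideanSpace ℝ (Fin N) × EuclideanSpace ℝ (Fin N))))) :=
    (isClosed_diffQuotSpace hN hs hR hΩ hΩR).isComplete
  have : CompleteSpace (diffQuotSpace s Ω) := completeSpace_coe_iff_isComplete.2 hcomp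
  obtain ⟨w, hw, hPw⟩ := (diffQuotSpace s Ω).starProjection_apply_mem (hFL.toLp F)
  have hP : (diffQuotSpace s Ω).starProjection (hFL.toLp F) = hw.memLp_diffQuot.toLp _ :=
    Lp.ext (hPw.trans hw.memLp_diffQuot.coeFn_toLp.symm)
  refine ⟨(tailMass N s R)⁻¹ • w, hw.smul _, fun v hv => ?_⟩
  have hvK : hv.memLp_diffQuot.toLp _ ∈ diffQuotSpace s Ω :=
    ⟨v, hv, hv.memLp_diffQuot.coeFn_toLp⟩
  have h1 := (diffQuotSpace s Ω).inner_starProjection_left_eq_right (hFL.toLp F)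
    (hv.memLp_diffQuot.toLp _)
  rw [Submodule.starProjection_eq_self_iff.2 hvK, hP, inner_toLp_eq_integral_mul,
    inner_toLp_eq_integral_mul, integral_congr_ae (ae_of_all _
      (mul_sqrt_tailKernel_mul_diffQuot hs hΩR hf0 hv.eq_zero)),
    integral_mul_tailKernel_fst (fun x => f x * v x)] at h1
  simp only [diffQuot_smul, Pi.smul_apply, smul_eq_mul, mul_assoc]
  rw [integral_const_mul, h1]
  field_simp

/-! ### Uniqueness and the quantitative estimate -/

lemma IsAdmissible.ae_eq_zero_of_integral_diffQuot_eq_zero {N : ℕ} (hN : 1 ≤ N) {s R : ℝ}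
    (hs : 0 < s) (hR : 0 < R) {Ω : Set (EuclideanSpace ℝ (Fin N))}
    (hΩR : ∀ x ∈ Ω, ∀ y ∈ Ω, ‖x - y‖ < R) {v : EuclideanSpace ℝ (Fin N) → ℝ}
    (hv : IsAdmissible s Ω v) (h : ∫ p, diffQuot s v p * diffQuot s v p = 0) :
    v =ᵐ[volume] 0 := by
  have h1 := hv.poincare hs hR hΩR
  rw [h] at h1
  have h2 : ∫ x, v x * v x = 0 :=
    le_antisymm (nonpos_of_mul_nonpos_right h1 (tailMass_pos hN hs hR))
      (integral_nonneg fun x => mul_self_nonneg _)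
  filter_upwards [(integral_eq_zero_iff_of_nonneg (fun x => mul_self_nonneg _)
    (hv.integrable_mul hv)).1 h2] with x hx
  simpa using hx

/-- Quantitative comparison of the solution with horizon `δ` with that of the fractional problem. -/
lemma integral_sq_sub_le {N : ℕ} (hN : 1 ≤ N) {s R δ : ℝ} (hs0 : 0 < s) (hs1 : s < 1)
    (hR : 0 < R) (hRδ : R ≤ δ) {Ω : Set (EuclideanSpace ℝ (Fin N))} (hΩ : MeasurableSet Ω)
    (hΩR : ∀ x ∈ Ω, ∀ y ∈ Ω, ‖x - y‖ < R) {f u w : EuclideanSpace ℝ (Fin N) → ℝ}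
    (hu : IsWeakSolution δ s Ω f u) (hwA : IsAdmissible s Ω w) (hw : IsFracWeakSolution s Ω f w)
    (hδ : 6 * tailMass N s δ ≤ tailMass N s R) :
    ∫ x, (Ω.indicator u - w) x * (Ω.indicator u - w) x ≤
      2 * tailMass N s δ / tailMass N s R * ∫ x, w x * w x := by
  have hc := fracConst_pos (N := N) hs0 hs1
  have hκ := tailMass_pos hN hs0 hR
  have hκδ := tailMass_nonneg N s δ
  have hδ0 := hR.trans_le hRδ
  have hΩδ : ∀ x ∈ Ω, ∀ y ∈ Ω, ‖x - y‖ < δ := fun x hx y hy => (hΩR x hx y hy).trans_le hRδ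
  have huA := hu.mem.isAdmissible_indicator hs0 hδ0 hΩ hΩδ
  have hdA := huA.sub hwA
  set d := Ω.indicator u - w with hd
  -- The error `d` is a test function for both problems.
  have h1 := hu.eq d ((hdA.memFracEnergySpace hs0 hΩ).memEnergySpace δ)
  rw [← (isFracWeakSolution_iff hs0 hΩ hwA).1 hw d hdA,
    gagliardoForm_interactionRegion_eq hs0 hδ0 hΩ hΩδ hu.mem hdA] at h1
  have h2 := mul_left_cancel₀ (by positivity) h1
  have h3 : ∫ p, diffQuot s d p * diffQuot s d p =
      2 * tailMass N s δ * ∫ x, Ω.indicator u x * d x := by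
    have : ∀ p, diffQuot s d p * diffQuot s d p =
        diffQuot s (Ω.indicator u) p * diffQuot s d p - diffQuot s w p * diffQuot s d p := by
      intro p
      nth_rewrite 1 [hd]
      rw [diffQuot_sub, Pi.sub_apply, sub_mul]
    rw [integral_congr_ae (ae_of_all _ this), integral_sub (huA.integrable_diffQuot_mul hdA)
      (hwA.integrable_diffQuot_mul hdA)]
    linarith
  have h4 := hdA.poincare hs0 hR hΩR
  -- Young's inequality: `(d + w) d ≤ 3/2 d² + 1/2 w²`.
  have h5 : ∫ x, Ω.indicator u x * d x ≤
      3 / 2 * (∫ x, d x * d x) + 1 / 2 * ∫ x, w x * w x := by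
    rw [← integral_const_mul, ← integral_const_mul, ← integral_add
      ((hdA.integrable_mul hdA).const_mul _) ((hwA.integrable_mul hwA).const_mul _)]
    refine integral_mono (huA.integrable_mul hdA)
      (((hdA.integrable_mul hdA).const_mul _).add ((hwA.integrable_mul hwA).const_mul _))
      fun x => ?_
    have hux : Ω.indicator u x = d x + w x := by simp [hd]
    simp only [hux]
    nlinarith [sq_nonneg (d x - w x)]
  have h6 := mul_le_mul_of_nonneg_left h5 (by positivity : 0 ≤ 2 * tailMass N s δ)
  have h7 : 0 ≤ ∫ x, d x * d x := integral_nonneg fun x => mul_self_nonneg _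
  have h8 := mul_le_mul_of_nonneg_right hδ h7
  -- The error term `3 κ(δ) ∫ d²` is at most half of `κ(R) ∫ d²` by the factor 6 in `hδ`, so it is
  -- absorbed on the left.
  rw [div_mul_eq_mul_div, le_div_iff₀ hκ]
  linarith

end RestrictedFrac

/-! ### The theorem -/

theorem theorem2p7 (N : ℕ) (hN : 1 ≤ N) (s : ℝ) (hs0 : 0 < s) (hs1 : s < 1)
    (Ω : Set (EuclideanSpace ℝ (Fin N))) (hΩo : IsOpen Ω) (hΩb : Bornology.IsBounded Ω)
    (f : EuclideanSpace ℝ (Fin N) → ℝ) (hf : MemLp f 2 (volume.restrict Ω))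
    (u : ℝ → EuclideanSpace ℝ (Fin N) → ℝ)
    (hu : ∀ δ : ℝ, 0 < δ → RestrictedFrac.IsWeakSolution δ s Ω f (u δ)) :
    ∃ uinf : EuclideanSpace ℝ (Fin N) → ℝ,
      RestrictedFrac.IsFracWeakSolution s Ω f uinf ∧
      (∀ w : EuclideanSpace ℝ (Fin N) → ℝ,
        RestrictedFrac.IsFracWeakSolution s Ω f w → w =ᵐ[volume] uinf) ∧
      ∀ δ : ℕ → ℝ, (∀ n, 0 < δ n) → Tendsto δ atTop atTop →
        ∃ φ : ℕ → ℕ, StrictMono φ ∧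
          Tendsto (fun n => eLpNorm (fun x => u (δ (φ n)) x - uinf x) 2 (volume.restrict Ω))
            atTop (𝓝 0) := by
  open RestrictedFrac in
  have hΩ := hΩo.measurableSet
  have hc := fracConst_pos (N := N) hs0 hs1
  obtain ⟨R, hR, hΩR⟩ : ∃ R : ℝ, 0 < R ∧ ∀ x ∈ Ω, ∀ y ∈ Ω, ‖x - y‖ < R := by
    -- Adding 1 makes the bound strict and `R` positive.
    refine ⟨Metric.diam Ω + 1, by positivity, fun x hx y hy => ?_⟩
    rw [← dist_eq_norm]
    exact (Metric.dist_le_diam_of_mem hΩb hx hy).trans_lt (lt_add_one _)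
  have hκ := tailMass_pos hN hs0 hR
  obtain ⟨w₀, hw₀, hw₀eq⟩ := exists_isAdmissible_integral_diffQuot_eq hN hs0 hR hΩ hΩR
    ((memLp_indicator_iff_restrict hΩ).2 hf) (fun x hx => Set.indicator_of_notMem hx f)
  -- The factor cancels `c_{N,s} / 2` in the weak formulation.
  have hwA := hw₀.smul (2 / fracConst N s)
  set w := (2 / fracConst N s) • w₀ with hwdef
  have hw : IsFracWeakSolution s Ω f w := by
    refine (isFracWeakSolution_iff hs0 hΩ hwA).2 fun v hv => ?_
    simp only [hwdef, diffQuot_smul, Pi.smul_apply, smul_eq_mul, mul_assoc]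
    rw [integral_const_mul, hw₀eq v hv, ← integral_indicator hΩ]
    simp only [← Set.indicator_mul_left]
    field_simp
  -- The subsequence is the identity, since the full sequence converges.
  refine ⟨w, hw, fun w' hw' => ?_, fun δ _ hδ => ⟨id, strictMono_id, ?_⟩⟩
  · have hw'A := hw'.mem.isAdmissible_indicator hs0 hΩ
    have hdA := hw'A.sub hwA
    have hd0 : Ω.indicator w' - w =ᵐ[volume] 0 := by
      refine hdA.ae_eq_zero_of_integral_diffQuot_eq_zero hN hs0 hR hΩR ?_
      have h1 := hw'.eq _ (hdA.memFracEnergySpace hs0 hΩ)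
      rw [gagliardoForm_univ_congr_ae hs0 (hw'.mem.ae_eq_indicator hΩ) (ae_eq_refl _),
        gagliardoForm_eq hs0, Measure.restrict_univ,
        ← (isFracWeakSolution_iff hs0 hΩ hwA).1 hw _ hdA] at h1
      have h2 := mul_left_cancel₀ (by positivity) h1
      have h3 : ∀ p, diffQuot s (Ω.indicator w' - w) p * diffQuot s (Ω.indicator w' - w) p =
          diffQuot s (Ω.indicator w') p * diffQuot s (Ω.indicator w' - w) p -
            diffQuot s w p * diffQuot s (Ω.indicator w' - w) p := by
        intro p
        rw [← sub_mul, diffQuot_sub, Pi.sub_apply]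
      rw [integral_congr_ae (ae_of_all _ h3), integral_sub (hw'A.integrable_diffQuot_mul hdA)
        (hwA.integrable_diffQuot_mul hdA), h2, sub_self]
    filter_upwards [hw'.mem.ae_eq_indicator hΩ, hd0] with x h1 h2
    rw [h1]
    simpa [sub_eq_zero] using h2
  · have hm := (tendsto_tailMass (N := N) hs0).comp hδ
    have hlim : Tendsto (fun n => ENNReal.ofReal (√(2 * tailMass N s (δ n) / tailMass N s R *
        ∫ x, w x * w x))) atTop (𝓝 0) := by
      have h1 := ((((hm.const_mul 2).div_const (tailMass N s R)).mul_const
        (∫ x, w x * w x)).sqrt)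
      simpa using ENNReal.tendsto_ofReal h1
    refine tendsto_of_tendsto_of_tendsto_of_le_of_le' tendsto_const_nhds hlim
      (Eventually.of_forall fun _ => zero_le) ?_
    filter_upwards [hδ.eventually_ge_atTop R,
      hm.eventually_le_const (show (0 : ℝ) < tailMass N s R / 6 by positivity)] with n h1 h2
    have hδ0 := hR.trans_le h1
    have hΩδ : ∀ x ∈ Ω, ∀ y ∈ Ω, ‖x - y‖ < δ n := fun x hx y hy => (hΩR x hx y hy).trans_le h1
    have hdA := ((hu _ hδ0).mem.isAdmissible_indicator hs0 hδ0 hΩ hΩδ).sub hwA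
    have hle := integral_sq_sub_le hN hs0 hs1 hR h1 hΩ hΩR (hu _ hδ0) hwA hw
      (by simp only [Function.comp] at h2; linarith)
    have he : eLpNorm (fun x => u (δ (id n)) x - w x) 2 (volume.restrict Ω) ≤
        eLpNorm (Ω.indicator (u (δ n)) - w) 2 volume := by
      refine (eLpNorm_congr_ae ?_).trans_le (eLpNorm_mono_measure _ Measure.restrict_le_self)
      filter_upwards [ae_restrict_mem hΩ] with x hx
      simp [hx]
    refine he.trans ?_
    rw [← ENNReal.ofReal_toReal hdA.memLp.2.ne, ← Lp.norm_toLp _ hdA.memLp]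
    refine ENNReal.ofReal_le_ofReal (Real.le_sqrt_of_sq_le ?_)
    rw [norm_toLp_sq_eq_integral_mul]
    exact hle
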